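/- A loop is an algebra $(X,\cdot,\backslash,/,e)$ satisfying the identities $x(x\backslash y)=y=x\backslash(xy)$, $(x/y)y=x=(xy)/y$ and $ex=xe=x$. A loop is abelian if it is an abelian group, and simple if its only normal subloops are $\{e\}$ and the loop itself, where a subloop is normal if it is invariant under the inner mapping group. A variety of loops is a class of loops defined by a set of identities. For a class $\mathcal X$ of loops, $\mathbf{HSP}(\mathcal X)$ is the class of homomorphic images of subloops of direct products of members of $\mathcal X$, and the join $\mathcal V\lor\mathcal W$ is the smallest variety of loops containing $\mathcal V$ and $\mathcal W$. An equation $\varepsilon$ in $m$ variables (between two loop terms) propagates in a loop $X$ if for all $x_1,\dots,x_m\in X$ such that $\varepsilon(x_1,\dots,x_m)$ holds, $\varepsilon(y_1,\dots,y_m)$ holds for all $y_1,\dots,y_m$ in the subloop $\langle x_1,\dots,x_m\rangle$; it propagates in a class of loops if it propagates in every member. Let $\mathcal V$ be a variety of loops and let $X_1,\dots,X_n$ be finite loops such that, for every $i$, every subloop $Y\le X_i$ (including $Y=X_i$) either belongs to $\mathcal V$ or is nonabelian and simple. If an equation $\varepsilon$ propagates in each of $X_1,\dots,X_n$ and in $\mathcal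 V$, then $\varepsilon$ propagates in the variety $\mathbf{HSP}(X_1,\dots,X_n)\lor\mathcal V$. -/

import Mathlib

universe u v

/-- A loop: multiplication with identity `1`, left division `ldiv x y` (written `x \ y`) and
right division `x / y`, in the signature in which loops form a variety. -/
class Loop (X : Type u) extends MulOneClass X, Div X where
  ldiv : X → X → X
  mul_ldiv : ∀ x y : X, x * ldiv x y = y
  ldiv_mul : ∀ x y : X, ldiv x (x * y) = y
  div_mul : ∀ x y : X, x / y * y = x
  mul_div : ∀ x y : X, x * y / y = x

namespace Loop

/-- A loop is abelian if it is an abelian group. -/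
def IsAbelian (X : Type u) [Loop X] : Prop :=
  (∀ x y : X, x * y = y * x) ∧ ∀ x y z : X, x * y * z = x * (y * z)

/-- Direct products, with componentwise operations. -/
instance instPi {I : Type v} (X : I → Type u) [∀ i, Loop (X i)] : Loop (∀ i, X i) where
  toMulOneClass := Pi.mulOneClass
  toDiv := Pi.instDiv
  ldiv x y := fun i => ldiv (x i) (y i)
  mul_ldiv x y := funext fun i => mul_ldiv (x i) (y i)
  ldiv_mul x y := funext fun i => ldiv_mul (x i) (y i)
  div_mul x y := funext fun i => div_mul (x i) (y i)
  mul_div x y := funext fun i => mul_div (x i) (y i)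

/-- Left translation `L_x`. -/
def leftTranslation {X : Type u} [Loop X] (x : X) : Equiv.Perm X where
  toFun y := x * y
  invFun y := ldiv x y
  left_inv y := ldiv_mul x y
  right_inv y := mul_ldiv x y

/-- Right translation `R_x`. -/
def rightTranslation {X : Type u} [Loop X] (x : X) : Equiv.Perm X where
  toFun y := y * x
  invFun y := y / x
  left_inv y := mul_div y x
  right_inv y := div_mul y x

/-- `L_{x,y} = L_{yx}⁻¹ L_y L_x`. -/
def innerL {X : Type u} [Loop X] (x y : X) : Equiv.Perm X :=
  (leftTranslation (y * x))⁻¹ * leftTranslation y * leftTranslation x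

/-- `R_{x,y} = R_{xy}⁻¹ R_y R_x`. -/
def innerR {X : Type u} [Loop X] (x y : X) : Equiv.Perm X :=
  (rightTranslation (x * y))⁻¹ * rightTranslation y * rightTranslation x

/-- `T_x = R_x⁻¹ L_x`. -/
def innerT {X : Type u} [Loop X] (x : X) : Equiv.Perm X :=
  (rightTranslation x)⁻¹ * leftTranslation x

/-- The inner mapping group of a loop. -/
def inn (X : Type u) [Loop X] : Subgroup (Equiv.Perm X) :=
  Subgroup.closure
    ({f | ∃ x y : X, f = innerL x y} ∪ {f | ∃ x y : X, f = innerR x y} ∪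
      {f | ∃ x : X, f = innerT x})

end Loop

/-- Subloops: subsets containing `1` and closed under multiplication and both divisions. -/
structure Subloop (X : Type u) [Loop X] extends Submonoid X where
  ldiv_mem' : ∀ {x y : X}, x ∈ carrier → y ∈ carrier → Loop.ldiv x y ∈ carrier
  div_mem' : ∀ {x y : X}, x ∈ carrier → y ∈ carrier → x / y ∈ carrier

namespace Subloop

instance instSetLike {X : Type u} [Loop X] : SetLike (Subloop X) X where
  coe A := A.carrier
  coe_injective A B h := by
    obtain ⟨A', _, _⟩ := A
    obtain ⟨B', _, _⟩ := B
    have hAB : A' = B' := SetLike.coe_injective h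
    subst hAB
    rfl

/-- A subloop is a loop under the restricted operations. -/
instance instLoop {X : Type u} [Loop X] (A : Subloop X) : Loop A where
  one := ⟨1, A.one_mem'⟩
  mul x y := ⟨x.1 * y.1, A.mul_mem' x.2 y.2⟩
  div x y := ⟨x.1 / y.1, A.div_mem' x.2 y.2⟩
  ldiv x y := ⟨Loop.ldiv x.1 y.1, A.ldiv_mem' x.2 y.2⟩
  one_mul x := Subtype.ext (one_mul x.1)
  mul_one x := Subtype.ext (mul_one x.1)
  mul_ldiv x y := Subtype.ext (Loop.mul_ldiv x.1 y.1)
  ldiv_mul x y := Subtype.ext (Loop.ldiv_mul x.1 y.1)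
  div_mul x y := Subtype.ext (Loop.div_mul x.1 y.1)
  mul_div x y := Subtype.ext (Loop.mul_div x.1 y.1)

/-- The subloop generated by a set. -/
def closure {X : Type u} [Loop X] (s : Set X) : Subloop X where
  carrier := {y | ∀ A : Subloop X, s ⊆ A → y ∈ A}
  one_mem' A _ := A.one_mem'
  mul_mem' hx hy A hA := A.mul_mem' (hx A hA) (hy A hA)
  ldiv_mem' hx hy A hA := A.ldiv_mem' (hx A hA) (hy A hA)
  div_mem' hx hy A hA := A.div_mem' (hx A hA) (hy A hA)

/-- A subloop is normal if it is invariant under the inner mapping group. -/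
def IsNormal {X : Type u} [Loop X] (A : Subloop X) : Prop :=
  ∀ f ∈ Loop.inn X, ∀ a ∈ A, f a ∈ A

end Subloop

namespace Loop

/-- A loop is simple if its only normal subloops are `{1}` and the whole loop. (The one-element
loop is simple in this sense, but it is abelian.) -/
def IsSimple (X : Type u) [Loop X] : Prop :=
  ∀ A : Subloop X, A.IsNormal → (A : Set X) = {1} ∨ (A : Set X) = Set.univ

/-- Terms in the signature of loops with variables from `α`. -/
inductive Term (α : Type v) : Type v
  | var : α → Term α
  | one : Term α
  | mul : Term α → Term α → Term α
  | ldiv : Term α → Term α → Term α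
  | div : Term α → Term α → Term α

/-- The value of a term under an assignment of its variables. -/
def Term.eval {α : Type v} {X : Type u} [Loop X] (x : α → X) : Term α → X
  | .var a => x a
  | .one => 1
  | .mul s t => s.eval x * t.eval x
  | .ldiv s t => Loop.ldiv (s.eval x) (t.eval x)
  | .div s t => s.eval x / t.eval x

/-- An equation between two loop terms with variables from `α`. -/
structure Equation (α : Type v) where
  lhs : Term α
  rhs : Term α

/-- The equation `ε` is true for the tuple `x`. -/
def Equation.HoldsAt {α : Type v} (ε : Equation α) {X : Type u} [Loop X] (x : α → X) : Prop :=
  ε.lhs.eval x = ε.rhs.eval x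

/-- The equation `ε` propagates in the loop `X`. -/
def Equation.PropagatesIn {n : ℕ} (ε : Equation (Fin n)) (X : Type u) [Loop X] : Prop :=
  ∀ x : Fin n → X, ε.HoldsAt x →
    ∀ y : Fin n → X, (∀ i, y i ∈ Subloop.closure (Set.range x)) → ε.HoldsAt y

end Loop

/-- Bundled loops; a class of loops is a `Set LoopCat`. -/
abbrev LoopCat : Type (u + 1) := CategoryTheory.Bundled Loop.{u}

namespace LoopCat

instance instLoop (A : LoopCat.{u}) : Loop A := A.str

/-- The bundled loop on a type with a loop structure. -/
abbrev of (X : Type u) [Loop X] : LoopCat.{u} := CategoryTheory.Bundled.mk X inferInstance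

/-- The equation `ε` propagates in every member of the class `𝒳`. -/
def Propagates {n : ℕ} (ε : Loop.Equation (Fin n)) (𝒳 : Set LoopCat.{u}) : Prop :=
  ∀ A ∈ 𝒳, ε.PropagatesIn A

/-- A variety of loops is a class of loops defined by a set of identities. -/
def IsVariety (𝒱 : Set LoopCat.{u}) : Prop :=
  ∃ E : Set (Loop.Equation ℕ), 𝒱 = {A : LoopCat.{u} | ∀ ε ∈ E, ∀ x : ℕ → A, ε.HoldsAt x}

/-- Homomorphic images of members of `𝒳`. -/
def H (𝒳 : Set LoopCat.{u}) : Set LoopCat.{u} :=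
  {A | ∃ B ∈ 𝒳, ∃ f : B →ₙ* A, Function.Surjective f}

/-- Loops isomorphic to subloops of members of `𝒳`. -/
def S (𝒳 : Set LoopCat.{u}) : Set LoopCat.{u} :=
  {A | ∃ B ∈ 𝒳, ∃ C : Subloop B, Nonempty (A ≃* C)}

/-- Loops isomorphic to direct products of families of members of `𝒳`. -/
def P (𝒳 : Set LoopCat.{u}) : Set LoopCat.{u} :=
  {A | ∃ (I : Type u) (B : I → LoopCat.{u}), (∀ i, B i ∈ 𝒳) ∧ Nonempty (A ≃* ∀ i, B i)}

/-- The class `HSP(𝒳)`. -/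
def HSP (𝒳 : Set LoopCat.{u}) : Set LoopCat.{u} := H (S (P 𝒳))

/-- The join `𝒱 ∨ 𝒲`: the smallest variety containing both classes. -/
def join (𝒱 𝒲 : Set LoopCat.{u}) : Set LoopCat.{u} :=
  ⋂₀ {𝒰 | IsVariety 𝒰 ∧ 𝒱 ⊆ 𝒰 ∧ 𝒲 ⊆ 𝒰}

end LoopCat

/-! Let `F` be the free loop on `m` generators `g`, let `θ` be the kernel of the map `φ` from `F` to
the given loop sending `g` to `x`, and lift `y` to a tuple `t` in `F`. The two sides of `ε` at `g`
are `θ`-related; the same is wanted at `t`.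

Let `α` be the verbal congruence of `𝒱`, and let `β j` be the kernels of the maps from `F` to some
`X i` with image outside `𝒱`. There are finitely many `β j`, each maximal with nonabelian quotient.
Propagation in `F/(θ ∨ α)`, a member of `𝒱`, relates the sides at `t` modulo `θ ∨ α`. Each `θ ∨ β j`
is `β j` or total, so propagation in `X i` relates them modulo `θ ∨ β j`.

The crux is distributivity, `comp_inf_of_isMaximal`: intersecting with a maximal nonabelian
congruence commutes with joining `θ`. Hence the sides at `t` are related modulo `θ ∨ (α ∩ ⋂ β j)`.
Pairs in `α ∩ ⋂ β j` are identities of `𝒱` and of every `X i`, hence of the variety, so they lie in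
`θ`. -/

namespace Loop

/-! ### Homomorphisms, subloops and terms. -/

section Basic

variable {X Y : Type u} [Loop X] [Loop Y]

theorem mul_left_cancel' {x y z : X} (h : x * y = x * z) : y = z := by
  rw [← ldiv_mul x y, h, ldiv_mul]

theorem mul_right_cancel' {x y z : X} (h : y * x = z * x) : y = z := by
  rw [← mul_div y x, h, mul_div]

theorem div_self' (x : X) : x / x = 1 := by
  rw [← mul_div 1 x, one_mul]

theorem map_one' (f : X →ₙ* Y) : f 1 = 1 :=
  mul_left_cancel' (x := f 1) (by rw [← map_mul, mul_one, mul_one])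

theorem map_ldiv (f : X →ₙ* Y) (x y : X) : f (ldiv x y) = ldiv (f x) (f y) :=
  mul_left_cancel' (x := f x) (by rw [← map_mul, mul_ldiv, mul_ldiv])

theorem map_div' (f : X →ₙ* Y) (x y : X) : f (x / y) = f x / f y :=
  mul_right_cancel' (x := f y) (by rw [← map_mul, div_mul, div_mul])

theorem Term.map_eval {α : Type v} (f : X →ₙ* Y) (x : α → X) (t : Term α) :
    f (t.eval x) = t.eval (fun a => f (x a)) := by
  induction t with
  | var a => rfl
  | one => exact map_one' f
  | mul s t hs ht => simp only [Term.eval, map_mul, hs, ht]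
  | ldiv s t hs ht => simp only [Term.eval, map_ldiv, hs, ht]
  | div s t hs ht => simp only [Term.eval, map_div', hs, ht]

/-- Renaming of variables. -/
def Term.rename {α : Type*} {β : Type*} (g : α → β) : Term α → Term β
  | .var a => .var (g a)
  | .one => .one
  | .mul s t => .mul (s.rename g) (t.rename g)
  | .ldiv s t => .ldiv (s.rename g) (t.rename g)
  | .div s t => .div (s.rename g) (t.rename g)

theorem Term.eval_rename {α : Type*} {β : Type*} (g : α → β) (x : β → X) (t : Term α) :
    (t.rename g).eval x = t.eval (fun a => x (g a)) := by
  induction t with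
  | var a => rfl
  | one => rfl
  | mul s t hs ht => simp only [Term.rename, Term.eval, hs, ht]
  | ldiv s t hs ht => simp only [Term.rename, Term.eval, hs, ht]
  | div s t hs ht => simp only [Term.rename, Term.eval, hs, ht]

/-- The inclusion of a subloop. -/
def _root_.Subloop.incl (A : Subloop X) : A →ₙ* X where
  toFun a := a.1
  map_mul' _ _ := rfl

/-- The range of a homomorphism. -/
def range (f : X →ₙ* Y) : Subloop Y where
  carrier := Set.range f
  one_mem' := ⟨1, map_one' f⟩
  mul_mem' := by
    rintro _ _ ⟨a, rfl⟩ ⟨b, rfl⟩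
    exact ⟨a * b, map_mul f a b⟩
  ldiv_mem' := by
    rintro _ _ ⟨a, rfl⟩ ⟨b, rfl⟩
    exact ⟨ldiv a b, map_ldiv f a b⟩
  div_mem' := by
    rintro _ _ ⟨a, rfl⟩ ⟨b, rfl⟩
    exact ⟨a / b, map_div' f a b⟩

/-- A homomorphism with codomain restricted to its range. -/
def rangeRestrict (f : X →ₙ* Y) : X →ₙ* range f where
  toFun a := ⟨f a, a, rfl⟩
  map_mul' a b := Subtype.ext (map_mul f a b)

theorem rangeRestrict_surjective (f : X →ₙ* Y) : Function.Surjective (rangeRestrict f) := by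
  rintro ⟨_, a, rfl⟩
  exact ⟨a, rfl⟩

/-- The preimage of a subloop. -/
def comap (f : X →ₙ* Y) (B : Subloop Y) : Subloop X where
  carrier := {a | f a ∈ B}
  one_mem' := by
    have h : (1 : Y) ∈ B := B.one_mem'
    simpa only [Set.mem_ofPred_eq, map_one' f] using h
  mul_mem' {a b} ha hb := by
    have h : f a * f b ∈ B := B.mul_mem' ha hb
    simpa only [Set.mem_ofPred_eq, map_mul] using h
  ldiv_mem' {a b} ha hb := by
    have h : ldiv (f a) (f b) ∈ B := B.ldiv_mem' ha hb
    simpa only [Set.mem_ofPred_eq, map_ldiv] using h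
  div_mem' {a b} ha hb := by
    have h : f a / f b ∈ B := B.div_mem' ha hb
    simpa only [Set.mem_ofPred_eq, map_div'] using h

theorem map_mem_closure {α : Type v} (f : X →ₙ* Y) (x : α → X) {a : X}
    (ha : a ∈ Subloop.closure (Set.range x)) :
    f a ∈ Subloop.closure (Set.range fun i => f (x i)) := by
  intro B hB
  refine ha (comap f B) ?_
  rintro _ ⟨i, rfl⟩
  exact hB ⟨i, rfl⟩

/-- If `ε` propagates in `Y`, then it is inherited by images of tuples under homomorphisms
to `Y`. -/
theorem Equation.PropagatesIn.map_eval_eq {m : ℕ} {ε : Equation (Fin m)}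
    (hY : ε.PropagatesIn Y) (f : X →ₙ* Y) {x t : Fin m → X}
    (ht : ∀ i, t i ∈ Subloop.closure (Set.range x))
    (hx : f (ε.lhs.eval x) = f (ε.rhs.eval x)) :
    f (ε.lhs.eval t) = f (ε.rhs.eval t) := by
  rw [Term.map_eval, Term.map_eval] at hx ⊢
  exact hY _ hx _ fun i => map_mem_closure f x (ht i)

end Basic

/-! ### Permuting congruences and quotients. -/

/-- Congruences of a loop. -/
structure Congruence (X : Type u) [Loop X] extends Setoid X where
  mul_rel : ∀ {a b c d : X}, r a b → r c d → r (a * c) (b * d)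
  ldiv_rel : ∀ {a b c d : X}, r a b → r c d → r (ldiv a c) (ldiv b d)
  div_rel : ∀ {a b c d : X}, r a b → r c d → r (a / c) (b / d)

namespace Congruence

section Operations

variable {X Y : Type u} [Loop X] [Loop Y]

theorem refl (θ : Congruence X) (a : X) : θ.r a a := θ.iseqv.refl a

theorem symm (θ : Congruence X) {a b : X} (h : θ.r a b) : θ.r b a := θ.iseqv.symm h

theorem trans (θ : Congruence X) {a b c : X} (h : θ.r a b) (h' : θ.r b c) : θ.r a c :=
  θ.iseqv.trans h h'

/-- The kernel of a homomorphism. -/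
def ker (f : X →ₙ* Y) : Congruence X where
  r a b := f a = f b
  iseqv := ⟨fun _ => rfl, fun h => h.symm, fun h h' => h.trans h'⟩
  mul_rel h h' := by rw [map_mul, map_mul, h, h']
  ldiv_rel h h' := by rw [map_ldiv, map_ldiv, h, h']
  div_rel h h' := by rw [map_div', map_div', h, h']

/-- The intersection of two congruences. -/
def inf (θ γ : Congruence X) : Congruence X where
  r a b := θ.r a b ∧ γ.r a b
  iseqv := ⟨fun a => ⟨θ.refl a, γ.refl a⟩, fun h => ⟨θ.symm h.1, γ.symm h.2⟩,
    fun h h' => ⟨θ.trans h.1 h'.1, γ.trans h.2 h'.2⟩⟩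
  mul_rel h h' := ⟨θ.mul_rel h.1 h'.1, γ.mul_rel h.2 h'.2⟩
  ldiv_rel h h' := ⟨θ.ldiv_rel h.1 h'.1, γ.ldiv_rel h.2 h'.2⟩
  div_rel h h' := ⟨θ.div_rel h.1 h'.1, γ.div_rel h.2 h'.2⟩

/-- Congruences permute, with Maltsev term `(x / y) * z`. -/
theorem permute (θ γ : Congruence X) {a b c : X} (h : θ.r a c) (h' : γ.r c b) :
    ∃ d, γ.r a d ∧ θ.r d b := by
  refine ⟨a / c * b, ?_, ?_⟩
  · have := γ.mul_rel (γ.refl (a / c)) h'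
    rwa [div_mul] at this
  · have := θ.mul_rel (θ.div_rel h (θ.refl c)) (θ.refl b)
    rwa [div_self', one_mul] at this

/-- The join of two congruences, which is their composition. -/
def comp (θ γ : Congruence X) : Congruence X where
  r a b := ∃ c, θ.r a c ∧ γ.r c b
  iseqv := by
    refine ⟨fun a => ⟨a, θ.refl a, γ.refl a⟩, ?_, ?_⟩
    · rintro a b ⟨c, h, h'⟩
      obtain ⟨d, h, h'⟩ := permute θ γ h h'
      exact ⟨d, θ.symm h', γ.symm h⟩
    · rintro a b e ⟨c, h, h'⟩ ⟨d, k, k'⟩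
      obtain ⟨c', l, l'⟩ := permute γ θ h' k
      exact ⟨c', θ.trans h l, γ.trans l' k'⟩
  mul_rel := by
    rintro _ _ _ _ ⟨c, h, h'⟩ ⟨d, k, k'⟩
    exact ⟨_, θ.mul_rel h k, γ.mul_rel h' k'⟩
  ldiv_rel := by
    rintro _ _ _ _ ⟨c, h, h'⟩ ⟨d, k, k'⟩
    exact ⟨_, θ.ldiv_rel h k, γ.ldiv_rel h' k'⟩
  div_rel := by
    rintro _ _ _ _ ⟨c, h, h'⟩ ⟨d, k, k'⟩
    exact ⟨_, θ.div_rel h k, γ.div_rel h' k'⟩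

theorem comp_left {θ γ : Congruence X} {a b : X} (h : θ.r a b) : (θ.comp γ).r a b :=
  ⟨b, h, γ.refl b⟩

theorem comp_right {θ γ : Congruence X} {a b : X} (h : γ.r a b) : (θ.comp γ).r a b :=
  ⟨a, θ.refl a, h⟩

/-- The quotient loop. -/
instance instLoopQuotient (θ : Congruence X) : Loop (Quotient θ.toSetoid) where
  one := Quotient.mk _ 1
  mul := Quotient.map₂ (· * ·) fun _ _ h _ _ h' => θ.mul_rel h h'
  div := Quotient.map₂ (· / ·) fun _ _ h _ _ h' => θ.div_rel h h'
  ldiv := Quotient.map₂ ldiv fun _ _ h _ _ h' => θ.ldiv_rel h h'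
  one_mul := by
    rintro ⟨x⟩
    exact congrArg (Quotient.mk _) (one_mul x)
  mul_one := by
    rintro ⟨x⟩
    exact congrArg (Quotient.mk _) (mul_one x)
  mul_ldiv := by
    rintro ⟨x⟩ ⟨y⟩
    exact congrArg (Quotient.mk _) (mul_ldiv x y)
  ldiv_mul := by
    rintro ⟨x⟩ ⟨y⟩
    exact congrArg (Quotient.mk _) (ldiv_mul x y)
  div_mul := by
    rintro ⟨x⟩ ⟨y⟩
    exact congrArg (Quotient.mk _) (div_mul x y)
  mul_div := by
    rintro ⟨x⟩ ⟨y⟩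
    exact congrArg (Quotient.mk _) (mul_div x y)

/-- The quotient homomorphism. -/
def proj (θ : Congruence X) : X →ₙ* Quotient θ.toSetoid where
  toFun := Quotient.mk _
  map_mul' _ _ := rfl

theorem proj_surjective (θ : Congruence X) : Function.Surjective θ.proj :=
  Quotient.mk_surjective

theorem proj_eq_iff {θ : Congruence X} {a b : X} : θ.proj a = θ.proj b ↔ θ.r a b :=
  Quotient.eq

/-! ### Congruences and normal subloops. -/

/-- The permutations of a loop that preserve a congruence in both directions. -/
def preservers (θ : Congruence X) : Subgroup (Equiv.Perm X) where
  carrier := {f | ∀ a b, θ.r (f a) (f b) ↔ θ.r a b}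
  one_mem' _ _ := Iff.rfl
  mul_mem' {f g} hf hg a b := (hf (g a) (g b)).trans (hg a b)
  inv_mem' {f} hf a b := by
    have h := hf (f⁻¹ a) (f⁻¹ b)
    rw [← Equiv.Perm.mul_apply, ← Equiv.Perm.mul_apply, mul_inv_cancel] at h
    exact h.symm

theorem leftTranslation_mem_preservers (θ : Congruence X) (x : X) :
    leftTranslation x ∈ θ.preservers := by
  refine fun a b => ⟨fun h => ?_, fun h => θ.mul_rel (θ.refl x) h⟩
  have := θ.ldiv_rel (θ.refl x) h
  change θ.r (ldiv x (x * a)) (ldiv x (x * b)) at this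
  rwa [ldiv_mul, ldiv_mul] at this

theorem rightTranslation_mem_preservers (θ : Congruence X) (x : X) :
    rightTranslation x ∈ θ.preservers := by
  refine fun a b => ⟨fun h => ?_, fun h => θ.mul_rel h (θ.refl x)⟩
  have := θ.div_rel h (θ.refl x)
  change θ.r (a * x / x) (b * x / x) at this
  rwa [mul_div, mul_div] at this

/-- The generators of `inn X` are words in translations and their inverses. -/
theorem inn_le_preservers (θ : Congruence X) : inn X ≤ θ.preservers := by
  have L := θ.leftTranslation_mem_preservers
  have R := θ.rightTranslation_mem_preservers
  refine (Subgroup.closure_le _).2 ?_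
  rintro f ((⟨x, y, rfl⟩ | ⟨x, y, rfl⟩) | ⟨x, rfl⟩)
  · exact mul_mem (mul_mem (inv_mem (L _)) (L _)) (L _)
  · exact mul_mem (mul_mem (inv_mem (R _)) (R _)) (R _)
  · exact mul_mem (inv_mem (R _)) (L _)

theorem _root_.Loop.inn_apply_one {f : Equiv.Perm X} (hf : f ∈ inn X) : f 1 = 1 := by
  suffices h : inn X ≤ MulAction.stabilizer (Equiv.Perm X) (1 : X) from h hf
  refine (Subgroup.closure_le _).2 ?_
  rintro f ((⟨x, y, rfl⟩ | ⟨x, y, rfl⟩) | ⟨x, rfl⟩)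
  · change ldiv (y * x) (y * (x * 1)) = 1
    rw [mul_one]
    simpa using ldiv_mul (y * x) (1 : X)
  · change (1 * x) * y / (x * y) = 1
    rw [one_mul, div_self']
  · change x * 1 / x = 1
    rw [mul_one, div_self']

/-- The class of `1`. -/
def oneClass (θ : Congruence X) : Subloop X where
  carrier := {a | θ.r a 1}
  one_mem' := θ.refl 1
  mul_mem' h h' := by simpa using θ.mul_rel h h'
  ldiv_mem' h h' := by
    have e : ldiv (1 : X) 1 = 1 := by simpa using ldiv_mul (1 : X) 1
    simpa only [Set.mem_ofPred_eq, e] using θ.ldiv_rel h h'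
  div_mem' h h' := by
    simpa only [Set.mem_ofPred_eq, div_self'] using θ.div_rel h h'

theorem oneClass_isNormal (θ : Congruence X) : θ.oneClass.IsNormal := by
  intro f hf a ha
  have h := (θ.inn_le_preservers hf a 1).2 ha
  rw [inn_apply_one hf] at h
  exact h

theorem rel_iff_div_mem_oneClass (θ : Congruence X) {a b : X} :
    θ.r a b ↔ a / b ∈ θ.oneClass := by
  constructor
  · intro h
    have := θ.div_rel h (θ.refl b)
    rwa [div_self'] at this
  · intro h
    have := θ.mul_rel (show θ.r (a / b) 1 from h) (θ.refl b)
    rwa [div_mul, one_mul] at this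

/-- The image of a congruence containing the kernel of a surjective homomorphism. -/
def map (f : X →ₙ* Y) (hf : Function.Surjective f) (δ : Congruence X)
    (hδ : ∀ a b, f a = f b → δ.r a b) : Congruence Y where
  r y z := ∃ a b, f a = y ∧ f b = z ∧ δ.r a b
  iseqv := by
    refine ⟨fun y => ?_, ?_, ?_⟩
    · obtain ⟨a, rfl⟩ := hf y
      exact ⟨a, a, rfl, rfl, δ.refl a⟩
    · rintro _ _ ⟨a, b, rfl, rfl, h⟩
      exact ⟨b, a, rfl, rfl, δ.symm h⟩
    · rintro _ _ _ ⟨a, b, rfl, rfl, h⟩ ⟨c, d, e, rfl, h'⟩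
      exact ⟨a, d, rfl, rfl, δ.trans h (δ.trans (hδ b c e.symm) h')⟩
  mul_rel := by
    rintro _ _ _ _ ⟨a, b, rfl, rfl, h⟩ ⟨c, d, rfl, rfl, h'⟩
    exact ⟨_, _, map_mul f _ _, map_mul f _ _, δ.mul_rel h h'⟩
  ldiv_rel := by
    rintro _ _ _ _ ⟨a, b, rfl, rfl, h⟩ ⟨c, d, rfl, rfl, h'⟩
    exact ⟨_, _, map_ldiv f _ _, map_ldiv f _ _, δ.ldiv_rel h h'⟩
  div_rel := by
    rintro _ _ _ _ ⟨a, b, rfl, rfl, h⟩ ⟨c, d, rfl, rfl, h'⟩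
    exact ⟨_, _, map_div' f _ _, map_div' f _ _, δ.div_rel h h'⟩

/-! ### Maximal congruences with nonabelian quotient. -/

/-- A congruence above which there are only itself and the total congruence. -/
def IsMaximal (β : Congruence X) : Prop :=
  ∀ δ : Congruence X, (∀ a b, β.r a b → δ.r a b) →
    (∀ a b, δ.r a b → β.r a b) ∨ ∀ a b, δ.r a b

/-- A congruence above the kernel descends to `Y`, where it is determined by its class of `1`, a
normal subloop; simplicity leaves two possibilities. -/
theorem isMaximal_ker (f : X →ₙ* Y) (hf : Function.Surjective f) (hY : IsSimple Y) :
    (ker f).IsMaximal := by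
  intro δ hδ
  have key : ∀ a b, (map f hf δ hδ).r (f a) (f b) → δ.r a b := by
    rintro a b ⟨a', b', ha, hb, h⟩
    exact δ.trans (hδ _ _ ha.symm) (δ.trans h (hδ _ _ hb))
  rcases hY _ (oneClass_isNormal (map f hf δ hδ)) with h | h
  · refine Or.inl fun a b hab => ?_
    have h1 := (rel_iff_div_mem_oneClass (map f hf δ hδ)).1 ⟨a, b, rfl, rfl, hab⟩
    rw [← SetLike.mem_coe, h, Set.mem_singleton_iff] at h1
    change f a = f b
    rw [← div_mul (f a) (f b), h1, one_mul]
  · refine Or.inr fun a b => key a b ((rel_iff_div_mem_oneClass _).2 ?_)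
    rw [← SetLike.mem_coe, h]
    trivial

/-- The quotient by the congruence is not an abelian group. -/
def IsNonabelian (β : Congruence X) : Prop :=
  ¬ ((∀ a b : X, β.r (a * b) (b * a)) ∧ ∀ a b c : X, β.r (a * b * c) (a * (b * c)))

theorem isNonabelian_ker (f : X →ₙ* Y) (hf : Function.Surjective f) (hY : ¬ IsAbelian Y) :
    (ker f).IsNonabelian := by
  rintro ⟨h, h'⟩
  refine hY ⟨hf.forall₂.2 fun a b => ?_, hf.forall₃.2 fun a b c => ?_⟩
  · simpa only [map_mul] using show f (a * b) = f (b * a) from h a b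
  · simpa only [map_mul] using show f (a * b * c) = f (a * (b * c)) from h' a b c

/-- Two congruences that jointly with `β` generate the total congruence, and whose
intersection lies below `β`, force the quotient by `β` to be abelian. -/
theorem IsNonabelian.not_inf_le {β : Congruence X} (hβ : β.IsNonabelian) {θ γ : Congruence X}
    (hθ : ∀ a b, (θ.comp β).r a b) (hγ : ∀ a b, (γ.comp β).r a b) :
    ¬ ∀ a b, (θ.inf γ).r a b → β.r a b := by
  intro hle
  refine hβ ⟨fun a b => ?_, fun a b c => ?_⟩
  all_goals
    -- Modulo `β`, replace `a` by an element of the `θ`-class of `1` and `b` by one of the `γ`-class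
    -- of `1`.
    obtain ⟨a', ha, ha'⟩ := hθ 1 a
    obtain ⟨b', hb, hb'⟩ := hγ 1 b
    replace ha := θ.symm ha
    replace hb := γ.symm hb
  -- Both products reduce to `b'` modulo `θ` and to `a'` modulo `γ`.
  · have h : β.r (a' * b') (b' * a') := by
      refine hle _ _ ⟨?_, ?_⟩
      · refine θ.trans (b := b') ?_ (θ.symm ?_)
        · simpa using θ.mul_rel ha (θ.refl b')
        · simpa using θ.mul_rel (θ.refl b') ha
      · refine γ.trans (b := a') ?_ (γ.symm ?_)
        · simpa using γ.mul_rel (γ.refl a') hb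
        · simpa using γ.mul_rel hb (γ.refl a')
    exact β.trans (β.symm (β.mul_rel ha' hb')) (β.trans h (β.mul_rel hb' ha'))
  -- Both products reduce to `b' * c` modulo `θ` and to `a' * c` modulo `γ`.
  · have h : β.r (a' * b' * c) (a' * (b' * c)) := by
      refine hle _ _ ⟨?_, ?_⟩
      · refine θ.trans (b := b' * c) ?_ (θ.symm ?_)
        · simpa using θ.mul_rel (θ.mul_rel ha (θ.refl b')) (θ.refl c)
        · simpa using θ.mul_rel ha (θ.refl (b' * c))
      · refine γ.trans (b := a' * c) ?_ (γ.symm ?_)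
        · simpa using γ.mul_rel (γ.mul_rel (γ.refl a') hb) (γ.refl c)
        · simpa using γ.mul_rel (γ.refl a') (γ.mul_rel hb (γ.refl c))
    exact β.trans (β.symm (β.mul_rel (β.mul_rel ha' hb') (β.refl c)))
      (β.trans h (β.mul_rel ha' (β.mul_rel hb' (β.refl c))))

/-- Joins distribute over intersections with maximal nonabelian congruences. -/
theorem comp_inf_of_isMaximal {β : Congruence X} (hmax : β.IsMaximal) (hβ : β.IsNonabelian)
    {θ γ : Congruence X} {a b : X} (h : (θ.comp γ).r a b) (h' : (θ.comp β).r a b) :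
    (θ.comp (γ.inf β)).r a b := by
  obtain ⟨c, hac, hcb⟩ := h
  -- If `θ ≤ β`, this is the modular law, and the given `c` already works.
  rcases hmax (θ.comp β) fun _ _ => comp_right with hθ | hθ
  · exact ⟨c, hac, hcb, β.trans (β.symm (hθ _ _ (comp_left hac))) (hθ _ _ h')⟩
  rcases hmax (γ.comp β) fun _ _ => comp_right with hγ | hγ
  · exact ⟨c, hac, hcb, hγ _ _ (comp_left hcb)⟩
  -- Now both joins with `β` are total, so `θ ∩ γ` cannot lie below `β`; its join with `β` is total,
  -- and `c` can be moved within its `θ ∩ γ`-class into the `β`-class of `b`.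
  rcases hmax ((θ.inf γ).comp β) fun _ _ => comp_right with hθγ | hθγ
  · exact absurd (fun _ _ k => hθγ _ _ (comp_left k)) (hβ.not_inf_le hθ hγ)
  · obtain ⟨d, ⟨hcd, hcd'⟩, hdb⟩ := hθγ c b
    exact ⟨d, θ.trans hac hcd, γ.trans (γ.symm hcd') hcb, hdb⟩

/-- Distributivity is iterated, cutting `α` down by one `β j` at a time. -/
theorem exists_rel_of_isMaximal {J : Type*} [Finite J] (β : J → Congruence X)
    (hmax : ∀ j, (β j).IsMaximal) (hβ : ∀ j, (β j).IsNonabelian) (θ α : Congruence X) {a b : X}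
    (h : (θ.comp α).r a b) (h' : ∀ j, (θ.comp (β j)).r a b) :
    ∃ c, θ.r a c ∧ α.r c b ∧ ∀ j, (β j).r c b := by
  classical
  have := Fintype.ofFinite J
  suffices H : ∀ s : Finset J, ∃ γ : Congruence X,
      (∀ x y, γ.r x y → α.r x y ∧ ∀ j ∈ s, (β j).r x y) ∧ (θ.comp γ).r a b by
    obtain ⟨γ, hγ, c, hac, hcb⟩ := H Finset.univ
    exact ⟨c, hac, (hγ _ _ hcb).1, fun j => (hγ _ _ hcb).2 j (Finset.mem_univ j)⟩
  intro s
  induction s using Finset.induction_on with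
  | empty => exact ⟨α, fun x y hxy => ⟨hxy, by simp⟩, h⟩
  | insert j s _ ih =>
    obtain ⟨γ, hγ, hab⟩ := ih
    refine ⟨γ.inf (β j), fun x y hxy => ⟨(hγ x y hxy.1).1, ?_⟩,
      comp_inf_of_isMaximal (hmax j) (hβ j) hab (h' j)⟩
    exact (Finset.forall_mem_insert _ _ _).2 ⟨hxy.2, (hγ x y hxy.1).2⟩

end Operations

end Congruence

/-! ### Free loops. -/

section Free

/-- Two terms are identified if they agree in all loops. -/
def freeSetoid (α : Type u) : Setoid (Term α) where
  r s t := ∀ (L : Type u) [Loop L] (x : α → L), s.eval x = t.eval x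
  iseqv := ⟨fun _ _ _ _ => rfl, fun h L _ x => (h L x).symm,
    fun h h' L _ x => (h L x).trans (h' L x)⟩

/-- The free loop on `α`. -/
def FreeLoop (α : Type u) : Type u := Quotient (freeSetoid α)

namespace FreeLoop

variable {α : Type u}

instance instLoop : Loop (FreeLoop α) where
  one := Quotient.mk _ .one
  mul := Quotient.map₂ .mul fun _ _ h _ _ h' L _ x => congrArg₂ (· * ·) (h L x) (h' L x)
  div := Quotient.map₂ .div fun _ _ h _ _ h' L _ x => congrArg₂ (· / ·) (h L x) (h' L x)
  ldiv := Quotient.map₂ .ldiv fun _ _ h _ _ h' L _ x => congrArg₂ Loop.ldiv (h L x) (h' L x)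
  one_mul := by
    rintro ⟨s⟩
    exact Quotient.sound fun L _ x => one_mul (s.eval x)
  mul_one := by
    rintro ⟨s⟩
    exact Quotient.sound fun L _ x => mul_one (s.eval x)
  mul_ldiv := by
    rintro ⟨s⟩ ⟨t⟩
    exact Quotient.sound fun L _ x => Loop.mul_ldiv (s.eval x) (t.eval x)
  ldiv_mul := by
    rintro ⟨s⟩ ⟨t⟩
    exact Quotient.sound fun L _ x => Loop.ldiv_mul (s.eval x) (t.eval x)
  div_mul := by
    rintro ⟨s⟩ ⟨t⟩
    exact Quotient.sound fun L _ x => Loop.div_mul (s.eval x) (t.eval x)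
  mul_div := by
    rintro ⟨s⟩ ⟨t⟩
    exact Quotient.sound fun L _ x => Loop.mul_div (s.eval x) (t.eval x)

/-- The class of a term. -/
def mk (t : Term α) : FreeLoop α := Quotient.mk _ t

/-- The free generators. -/
def of (a : α) : FreeLoop α := mk (.var a)

/-- The homomorphism extending an assignment of the generators. -/
def lift {L : Type u} [Loop L] (x : α → L) : FreeLoop α →ₙ* L where
  toFun := Quotient.lift (fun t => t.eval x) fun _ _ h => h L x
  map_mul' := by
    rintro ⟨s⟩ ⟨t⟩
    rfl

theorem mem_closure_of (a : FreeLoop α) : a ∈ Subloop.closure (Set.range (of (α := α))) := by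
  intro A hA
  obtain ⟨t, rfl⟩ : ∃ t, mk t = a := Quotient.exists_rep a
  induction t with
  | var i => exact hA ⟨i, rfl⟩
  | one => exact A.one_mem'
  | mul s t hs ht => exact A.mul_mem' hs ht
  | ldiv s t hs ht => exact A.ldiv_mem' hs ht
  | div s t hs ht => exact A.div_mem' hs ht

theorem mem_range_lift {L : Type u} [Loop L] {x : α → L} {y : L}
    (hy : y ∈ Subloop.closure (Set.range x)) : ∃ a, lift x a = y := by
  refine hy (range (lift x)) ?_
  rintro _ ⟨i, rfl⟩
  exact ⟨of i, rfl⟩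

end FreeLoop

end Free

end Loop

/-! ### Identities, joins and verbal congruences. -/

namespace LoopCat

open Loop

/-- Identities are preserved by `HSP`. -/
theorem eval_eq_of_mem_HSP {α : Type v} {s t : Term α} {𝒳 : Set LoopCat.{u}}
    (h : ∀ A ∈ 𝒳, ∀ x : α → A, s.eval x = t.eval x) {A : LoopCat.{u}} (hA : A ∈ HSP 𝒳)
    (x : α → A) : s.eval x = t.eval x := by
  obtain ⟨B, ⟨C, ⟨I, D, hD, ⟨e⟩⟩, K, ⟨e'⟩⟩, f, hf⟩ := hA
  choose y hy using fun a => hf (x a)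
  obtain rfl : x = fun a => f (y a) := funext fun a => (hy a).symm
  rw [← Term.map_eval, ← Term.map_eval]
  refine congrArg f (e'.injective (Subtype.ext (e.injective (funext fun i => ?_))))
  let g : B →ₙ* D i :=
    ((Pi.evalMulHom (fun i => (D i : Type u)) i).comp e.toMulHom).comp
      (K.incl.comp e'.toMulHom)
  change g (s.eval y) = g (t.eval y)
  rw [Term.map_eval, Term.map_eval]
  exact h _ (hD i) _

/-- The identities of terms in finitely many variables common to `𝒳` and `𝒱` hold in
`HSP(𝒳) ∨ 𝒱`. -/
theorem eval_eq_of_mem_join {m : ℕ} {s t : Term (ULift.{u} (Fin m))} {𝒳 𝒱 : Set LoopCat.{u}}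
    (h𝒳 : ∀ A ∈ 𝒳, ∀ x : ULift.{u} (Fin m) → A, s.eval x = t.eval x)
    (h𝒱 : ∀ A ∈ 𝒱, ∀ x : ULift.{u} (Fin m) → A, s.eval x = t.eval x)
    {A : LoopCat.{u}} (hA : A ∈ join (HSP 𝒳) 𝒱) (x : ULift.{u} (Fin m) → A) :
    s.eval x = t.eval x := by
  let g : ULift.{u} (Fin m) → ℕ := fun i => i.down
  let η : Equation ℕ := ⟨s.rename g, t.rename g⟩
  have hU := hA {B : LoopCat.{u} | ∀ ε ∈ ({η} : Set (Equation ℕ)), ∀ x : ℕ → B, ε.HoldsAt x} (by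
    refine ⟨⟨{η}, rfl⟩, ?_, ?_⟩
    · rintro B hB _ rfl y
      rw [Equation.HoldsAt, Term.eval_rename, Term.eval_rename]
      exact eval_eq_of_mem_HSP h𝒳 hB _
    · rintro B hB _ rfl y
      rw [Equation.HoldsAt, Term.eval_rename, Term.eval_rename]
      exact h𝒱 B hB _)
  -- Indices from `m` on do not occur in the renamed terms; `1` is a filler.
  have := hU η rfl fun k => if hk : k < m then x ⟨⟨k, hk⟩⟩ else 1
  rw [Equation.HoldsAt, Term.eval_rename, Term.eval_rename] at this
  simpa [g] using this

/-- The verbal congruence of `F` with respect to `𝒱`. -/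
def verbal (𝒱 : Set LoopCat.{u}) (F : Type u) [Loop F] : Congruence F where
  r a b := ∀ B ∈ 𝒱, ∀ f : F →ₙ* B, f a = f b
  iseqv := ⟨fun _ _ _ _ => rfl, fun h B hB f => (h B hB f).symm,
    fun h h' B hB f => (h B hB f).trans (h' B hB f)⟩
  mul_rel h h' B hB f := by rw [map_mul, map_mul, h B hB f, h' B hB f]
  ldiv_rel h h' B hB f := by rw [map_ldiv, map_ldiv, h B hB f, h' B hB f]
  div_rel h h' B hB f := by rw [Loop.map_div', Loop.map_div', h B hB f, h' B hB f]

/-- An instance of a defining identity lifts to `F`, where its two sides agree under every map to a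
member of `𝒱`, so they are verbally related. -/
theorem IsVariety.quotient_mem {𝒱 : Set LoopCat.{u}} (h𝒱 : IsVariety 𝒱) {F : Type u} [Loop F]
    (δ : Congruence F) (hδ : ∀ a b, (verbal 𝒱 F).r a b → δ.r a b) :
    LoopCat.of (Quotient δ.toSetoid) ∈ 𝒱 := by
  obtain ⟨E, rfl⟩ := h𝒱
  intro ε hε x
  choose y hy using fun k => δ.proj_surjective (x k)
  obtain rfl : x = fun k => δ.proj (y k) := funext fun k => (hy k).symm
  change ε.lhs.eval (fun k => δ.proj (y k)) = ε.rhs.eval (fun k => δ.proj (y k))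
  rw [← Term.map_eval, ← Term.map_eval, Congruence.proj_eq_iff]
  refine hδ _ _ fun B hB f => ?_
  rw [Term.map_eval, Term.map_eval]
  exact hB ε hε _

end LoopCat

/-! ### The propagation theorem. -/

open Loop LoopCat in
theorem mainTheorem1 (𝒱 : Set LoopCat.{u}) (h𝒱 : LoopCat.IsVariety 𝒱)
    (n : ℕ) (X : Fin n → LoopCat.{u}) (hfin : ∀ i, Finite (X i))
    (hsub : ∀ (i : Fin n) (Y : Subloop (X i)),
      LoopCat.of Y ∈ 𝒱 ∨ (¬ Loop.IsAbelian Y ∧ Loop.IsSimple Y))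
    (m : ℕ) (ε : Loop.Equation (Fin m))
    (hX : ∀ i, ε.PropagatesIn (X i)) (hprop : LoopCat.Propagates ε 𝒱) :
    LoopCat.Propagates ε (LoopCat.join (LoopCat.HSP (Set.range X)) 𝒱) := by
  intro A hA x hx y hy
  let F := FreeLoop (ULift.{u} (Fin m))
  let g : Fin m → F := fun i => FreeLoop.of ⟨i⟩
  let φ : F →ₙ* A := FreeLoop.lift fun i => x i.down
  have hrange : Set.range (fun i : ULift.{u} (Fin m) => x i.down) = Set.range x :=
    ULift.down_surjective.range_comp x
  have hg : Set.range g = Set.range (FreeLoop.of (α := ULift.{u} (Fin m))) :=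
    ULift.up_surjective.range_comp FreeLoop.of
  choose t ht using fun i => FreeLoop.mem_range_lift (hrange ▸ hy i)
  have htg : ∀ i, t i ∈ Subloop.closure (Set.range g) := fun i => by
    rw [hg]
    exact FreeLoop.mem_closure_of _
  obtain rfl : y = fun i => φ (t i) := funext fun i => (ht i).symm
  rw [Equation.HoldsAt, ← Term.map_eval, ← Term.map_eval]
  let θ : Congruence F := Congruence.ker φ
  have hθ : θ.r (ε.lhs.eval g) (ε.rhs.eval g) := by
    change φ _ = φ _
    rw [Term.map_eval, Term.map_eval]
    exact hx
  let f : (Σ i, ULift.{u} (Fin m) → X i) → Σ i, F →ₙ* X i := fun p => ⟨p.1, FreeLoop.lift p.2⟩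
  -- Finite, because an assignment of `m` generators into one of finitely many finite loops
  -- determines the map.
  let J := {p : Σ i, ULift.{u} (Fin m) → X i // LoopCat.of (range (f p).2) ∉ 𝒱}
  let β : J → Congruence F := fun j => Congruence.ker (rangeRestrict (f j.1).2)
  have hβ : ∀ j : J, (β j).IsMaximal ∧ (β j).IsNonabelian := fun j => by
    obtain ⟨h, h'⟩ := (hsub _ (range (f j.1).2)).resolve_left j.2
    exact ⟨Congruence.isMaximal_ker _ (rangeRestrict_surjective _) h',
      Congruence.isNonabelian_ker _ (rangeRestrict_surjective _) h⟩
  obtain ⟨c, hac, hcb, hβc⟩ := Congruence.exists_rel_of_isMaximal β (fun j => (hβ j).1)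
    (fun j => (hβ j).2) θ (verbal 𝒱 F) (a := ε.lhs.eval t) (b := ε.rhs.eval t)
    (by
      rw [← Congruence.proj_eq_iff]
      refine (hprop _ (h𝒱.quotient_mem _ fun _ _ => Congruence.comp_right)).map_eval_eq
        (Congruence.proj _) htg ?_
      exact Congruence.proj_eq_iff.2 (Congruence.comp_left hθ))
    (by
      intro j
      -- Either `θ ≤ β j`, so `ε` holds at the image of `g` in `X i` and propagates to that of `t`,
      -- or the join is total.
      rcases (hβ j).1 (θ.comp (β j)) fun _ _ => Congruence.comp_right with h | h
      · refine Congruence.comp_right (Subtype.ext ?_)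
        refine (hX _).map_eval_eq (f j.1).2 htg ?_
        exact congrArg Subtype.val (h _ _ (Congruence.comp_left hθ))
      · exact h _ _)
  refine Eq.trans hac ?_
  obtain ⟨s, rfl⟩ : ∃ s, FreeLoop.mk s = c := Quotient.exists_rep c
  obtain ⟨s', hs'⟩ : ∃ s', FreeLoop.mk s' = ε.rhs.eval t := Quotient.exists_rep _
  rw [← hs'] at hcb hβc ⊢
  refine eval_eq_of_mem_join (𝒳 := Set.range X) ?_ ?_ hA _
  · rintro _ ⟨i, rfl⟩ z
    -- An image in `𝒱` is handled by the verbal congruence, any other by its own `β j`.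
    by_cases hz : LoopCat.of (range (f ⟨i, z⟩).2) ∈ 𝒱
    · exact congrArg Subtype.val (hcb _ hz (rangeRestrict (f ⟨i, z⟩).2))
    · exact congrArg Subtype.val (hβc ⟨⟨i, z⟩, hz⟩)
  · exact fun B hB z => hcb B hB (FreeLoop.lift z)
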